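/- Let $g\ge 3$ and let $S_g$ be the closed oriented smooth surface of genus $g$. Let $(\alpha,\beta)$ be a minimally intersecting filling pair on $S_g$: $\alpha,\beta$ are smooth simple closed curves in minimal position (they are transverse and $|\alpha\cap\beta|$ is the geometric intersection number $i(\alpha,\beta)$, the least number of common points of curves isotopic to $\alpha$ and $\beta$), every connected component of $S_g\setminus(\alpha\cup\beta)$ is an open disk, and $i(\alpha,\beta)$ is minimal among all such filling pairs on $S_g$. Suppose that $\alpha$ and $\beta$ intersect coherently, i.e. the absolute value of their algebraic intersection number equals $i(\alpha,\beta)$. Cut $S_g$ along $\alpha\cup\beta$ to obtain a $4(2g-1)$-gon; that is, let $P$ be any $C^1$ map from the closed regular $4(2g-1)$-gon to $S_g$ with invertible derivative everywhere (up to the boundary), mapping the interior of the polygon bijectively to $S_g\setminus(\alpha\cup\beta)$, the vertices to points of $\alpha\cap\beta$, and each open side bijectively onto a connected component of $\alpha\setminus\beta$ or of $\beta\setminus\alpha$, such that each of these components is the image of exactly two sides; two sides with the same image are called identified. Then at least one side that comes from $\alpha$ is not identified with the opposite side of the polygon, and at least one side that comes from $\beta$ is not identified with the opposite side of the polygon.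 -/

import Mathlib

open Set Manifold
open scoped ContDiff

universe u

noncomputable section

namespace FillingPairs

/-- The atlas of the smooth surface `S` is an oriented one: all changes of charts have positive
Jacobian determinant. -/
def IsOriented (S : Type u) [TopologicalSpace S]
    [ChartedSpace (EuclideanSpace ℝ (Fin 2)) S] : Prop :=
  ∀ e ∈ atlas (EuclideanSpace ℝ (Fin 2)) S, ∀ e' ∈ atlas (EuclideanSpace ℝ (Fin 2)) S,
    ∀ x ∈ (e.symm.trans e').source, 0 < (fderiv ℝ (e.symm.trans e') x).det

/-- First singular homology of `S` with integer coefficients. -/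
def firstHomology (S : Type u) [TopologicalSpace S] : ModuleCat.{u} ℤ :=
  ((AlgebraicTopology.singularHomologyFunctor (ModuleCat.{u} ℤ) 1).obj
    (ModuleCat.of ℤ (ULift.{u} ℤ))).obj (TopCat.of S)

/-- `S`, given as a smooth surface with an oriented atlas, is the closed oriented surface of genus
`g`: it is compact, Hausdorff, connected, and its first homology is free of rank `2 g`. -/
structure IsClosedSurface (g : ℕ) (S : Type u) [TopologicalSpace S]
    [ChartedSpace (EuclideanSpace ℝ (Fin 2)) S] : Prop where
  smooth : IsManifold (𝓡 2) ∞ S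
  oriented : IsOriented S
  t2 : T2Space S
  compact : CompactSpace S
  connected : ConnectedSpace S
  genus : Nonempty (firstHomology S ≃ₗ[ℤ] (Fin (2 * g) → ℤ))

variable {S : Type u} [TopologicalSpace S]

/-- `γ : ℝ → S` is a 1-periodic parametrization of a simple closed curve of `S`. -/
def IsSimpleLoop (γ : ℝ → S) : Prop :=
  Continuous γ ∧ ∀ s t : ℝ, γ s = γ t ↔ ∃ k : ℤ, t = s + k

variable [ChartedSpace (EuclideanSpace ℝ (Fin 2)) S]

/-- The velocity of a curve, in the coordinates of the preferred chart at `γ t`. -/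
def velocity (γ : ℝ → S) (t : ℝ) : EuclideanSpace ℝ (Fin 2) :=
  mfderiv 𝓘(ℝ, ℝ) (𝓡 2) γ t (1 : ℝ)

variable (S) in
/-- A smooth simple closed curve, by a regular 1-periodic parametrization. -/
structure Curve where
  toFun : ℝ → S
  smooth : ContMDiff 𝓘(ℝ, ℝ) (𝓡 2) ∞ toFun
  regular : ∀ t, velocity toFun t ≠ 0
  simple : IsSimpleLoop toFun

/-- The curve as a subset of the surface. -/
def Curve.carrier (α : Curve S) : Set S := range α.toFun

/-- Isotopy of simple closed curves. -/
def Isotopic (α α' : Curve S) : Prop :=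
  ∃ H : unitInterval × ℝ → S, Continuous H ∧ (∀ r, IsSimpleLoop fun t => H (r, t)) ∧
    (∀ t, H (0, t) = α.toFun t) ∧ ∀ t, H (1, t) = α'.toFun t

/-- The geometric intersection number `i(α, β)`: the least number of common points of curves
isotopic to `α` and `β`. -/
def geometricIntersection (α β : Curve S) : ℕ∞ :=
  ⨅ (α' : Curve S) (β' : Curve S) (_ : Isotopic α α') (_ : Isotopic β β'),
    (α'.carrier ∩ β'.carrier).encard

/-- The determinant of the matrix with columns `v` and `w`. -/
def det₂ (v w : EuclideanSpace ℝ (Fin 2)) : ℝ := v 0 * w 1 - v 1 * w 0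

/-- The parameters in a fundamental domain at which `α` and `β` meet; they correspond one to one to
the points of `α ∩ β`. -/
def crossings (α β : Curve S) : Set (ℝ × ℝ) :=
  {p | p.1 ∈ Ico (0 : ℝ) 1 ∧ p.2 ∈ Ico (0 : ℝ) 1 ∧ α.toFun p.1 = β.toFun p.2}

/-- All intersections of `α` and `β` are transverse. -/
def Transverse (α β : Curve S) : Prop :=
  ∀ p ∈ crossings α β, det₂ (velocity α.toFun p.1) (velocity β.toFun p.2) ≠ 0

/-- The algebraic intersection number of `α` and `β` for the given orientation of `S` and the
given directions of the curves (its absolute value depends on neither): the sum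
of the signs of the crossings. -/
def algebraicIntersection (α β : Curve S) : ℤ :=
  ∑ᶠ p ∈ crossings α β,
    ((SignType.sign (det₂ (velocity α.toFun p.1) (velocity β.toFun p.2)) : SignType) : ℤ)

/-- Minimal position: the curves are transverse and have as few common points as their isotopy
classes allow. -/
def InMinimalPosition (α β : Curve S) : Prop :=
  Transverse α β ∧ (α.carrier ∩ β.carrier).encard = geometricIntersection α β

/-- A filling pair: simple closed curves in minimal position such that every connected component
of the complement is an open disk. -/
def IsFillingPair (α β : Curve S) : Prop :=
  InMinimalPosition α β ∧ ∀ x ∉ α.carrier ∪ β.carrier,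
    Nonempty (connectedComponentIn (α.carrier ∪ β.carrier)ᶜ x ≃ₜ Metric.ball (0 : ℂ) 1)

/-- A minimally intersecting filling pair: a filling pair whose intersection number is minimal
among all filling pairs of the surface. -/
def IsMinimallyIntersecting (α β : Curve S) : Prop :=
  IsFillingPair α β ∧ ∀ α' β' : Curve S, IsFillingPair α' β' →
    geometricIntersection α β ≤ geometricIntersection α' β'

/-- The curves intersect coherently: the absolute value of the algebraic intersection number is
the geometric intersection number. -/
def IntersectCoherently (α β : Curve S) : Prop :=
  ((algebraicIntersection α β).natAbs : ℕ∞) = geometricIntersection α β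

/-- The vertices of the regular `m`-gon in counterclockwise order; `k` and `k + m` give the same
vertex. -/
def vertex (m : ℕ) (k : ℤ) : ℂ := Complex.exp (2 * Real.pi * Complex.I * (k : ℂ) / (m : ℂ))

/-- The regular `m`-gon. -/
def polygon (m : ℕ) : Set ℂ := convexHull ℝ (range (vertex m))

/-- The `k`-th (open) side of the regular `m`-gon; `k` and `k + m` give the same side. -/
def side (m : ℕ) (k : ℤ) : Set ℂ := openSegment ℝ (vertex m k) (vertex m (k + 1))

/-- The (open) arcs into which the two curves cut each other: the components of `α \ β` and
those of `β \ α`. -/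
def arcs (α β : Curve S) : Set (Set S) :=
  {e | ∃ x ∈ α.carrier \ β.carrier, e = connectedComponentIn (α.carrier \ β.carrier) x} ∪
  {e | ∃ x ∈ β.carrier \ α.carrier, e = connectedComponentIn (β.carrier \ α.carrier) x}

/-- Cutting `S` along `α` and `β` gives the `m`-gon with the gluing map `P`. As the surface and the
curves are smooth and the curves transverse, the surface cut open is a smooth surface
with corners; so `P` is taken of class `C¹` and regular up to the boundary of the polygon.
The values of `P` outside the polygon are irrelevant. -/
structure IsCutPolygon (α β : Curve S) (m : ℕ) (P : ℂ → S) : Prop where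
  /-- `P` is of class `C¹` on the closed polygon. -/
  contMDiffOn : ContMDiffOn 𝓘(ℝ, ℂ) (𝓡 2) 1 P (polygon m)
  /-- The derivative of `P` is invertible on the closed polygon. -/
  regular : ∀ z ∈ polygon m,
    Function.Injective (mfderivWithin 𝓘(ℝ, ℂ) (𝓡 2) P (polygon m) z)
  /-- The interior of the polygon is mapped bijectively to the complement of the curves. -/
  bijOn_interior : BijOn P (interior (polygon m)) (α.carrier ∪ β.carrier)ᶜ
  /-- The vertices are mapped to intersection points of the curves. -/
  map_vertex : ∀ k, P (vertex m k) ∈ α.carrier ∩ β.carrier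
  /-- Every side is mapped bijectively to an arc. -/
  injOn_side : ∀ k, InjOn P (side m k)
  image_side : ∀ k, P '' side m k ∈ arcs α β
  /-- Every arc has exactly two copies among the sides. -/
  two_copies : ∀ e ∈ arcs α β, {k : ℤ | 0 ≤ k ∧ k < m ∧ P '' side m k = e}.ncard = 2

/-- The sides `j` and `k` of the polygon are copies of the same arc, that is, the gluing map
identifies them. -/
def Identified (m : ℕ) (P : ℂ → S) (j k : ℤ) : Prop := P '' side m j = P '' side m k

end FillingPairs

end

/-! Put n = 2g − 1, which is odd and at least 3; the polygon has 4n sides. Suppose every α-side is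
glued to its opposite. Coherence forces all crossings to have the same sign
(`IntersectCoherently.exists_sign`). The gluing map preserves or reverses orientation throughout
(`exists_forall_mul_det₂_pos`), and the polygon turns left at every vertex (`cross_sides_pos`).
Hence α- and β-sides alternate and their directions repeat with period four: α forwards, β one way,
α backwards, β the other way. Since 2n ≡ 2 mod 4, opposite α-sides run in opposite directions, which
determines how their end points are glued.

Number the forward α-sides by i mod n. One step along β, in a suitable direction, moves the start of
side i to the start of side i − (n+1)/2, and the end of side i to the end of side i + (n+1)/2. As β
runs through all crossings, the end of side 0 is the start of some side c. After t steps the end of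
side t(n+1)/2 is the start of side c − t(n+1)/2. Because (n+1)/2 is the inverse of 2 mod n, t = c
gives an α-arc whose two ends coincide (`exists_rel_self`). So α meets β only once and consists of a
single arc, yet at least three sides lie on it, while every arc has exactly two copies
(`exists_not_identified`). Exchanging the curves settles β. -/

namespace FillingPairs

noncomputable section

variable {S : Type u} [TopologicalSpace S]

/-! ### Combinatorics of the gluing -/

/-- A permutation-free form of the combinatorics of a `4n`-gon, `n` odd: if all sides of the first
type are glued to the opposite ones, then the relation along the first curve has a fixed point. -/
theorem exists_rel_self {X : Type*} (v : ℤ → X) (n : ℤ) (hn : Odd n) (hpos : 0 < n)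
    (hv : ∀ k, v (k + 4 * n) = v k) (A B : X → X → Prop)
    (hB : ∀ x y z, B x y → B x z → y = z)
    (hA : ∀ i, A (v (4 * i)) (v (4 * i + 1)))
    (hB₁ : ∀ i, B (v (4 * i + 1)) (v (4 * i + 2)))
    (hB₃ : ∀ i, B (v (4 * i + 4)) (v (4 * i + 3)))
    (h₀ : ∀ i, v (4 * i + 2 * n + 1) = v (4 * i))
    (h₁ : ∀ i, v (4 * i + 2 * n) = v (4 * i + 1))
    (hirr : ∀ Y : Set X, v 0 ∈ Y → (∀ x ∈ Y, ∀ y, B x y → y ∈ Y) → v 1 ∈ Y) :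
    ∃ x, A x x := by
  obtain ⟨a, rfl⟩ := hn
  have hper : ∀ (q : ℕ) k, v (k + 4 * (2 * a + 1) * q) = v k := by
    intro q
    induction q with
    | zero => intro k; simp
    | succ q ih =>
      intro k
      rw [← ih k, ← hv (k + 4 * (2 * a + 1) * (q : ℤ))]
      congr 1
      push_cast
      ring
  -- The step `B` leads from `v (4 * i)` to `v (4 * i - 1)`, which `h₀` glues to a start a + 1 =
  -- (n+1)/2 places back.
  have hdown : ∀ i, B (v (4 * i)) (v (4 * (i - (a + 1)))) := by
    intro i
    have h := hB₃ (i - 1)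
    rw [← h₀ (i - (a + 1))]
    convert h using 2 <;> ring
  have hup : ∀ i, B (v (4 * i + 1)) (v (4 * (i + (a + 1)) + 1)) := by
    intro i
    have h := hB₁ i
    have e : v (4 * (i + (a + 1)) + 1) = v (4 * i + 2) := by
      rw [← hv (4 * i + 2), ← h₁]
      congr 1
      ring
    rwa [e]
  -- By `hdown` the starts are closed under `B`, so they include `v 1`.
  obtain ⟨i₀, hi₀⟩ := hirr {x | ∃ i, v (4 * i) = x} ⟨0, by simp⟩ (by
    rintro x ⟨i, rfl⟩ y hy
    exact ⟨_, hB _ _ _ (hdown i) hy⟩)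
  obtain ⟨c, hc⟩ : ∃ c : ℕ, v (4 * (c : ℤ)) = v 1 := by
    -- Adding a large multiple of n makes the index a natural number, which can then serve as a
    -- number of steps.
    refine ⟨(i₀ + (2 * a + 1) * i₀.natAbs).toNat, ?_⟩
    rw [Int.toNat_of_nonneg, ← hi₀, ← hper i₀.natAbs (4 * i₀)]
    · congr 1
      ring
    · have h1 : -i₀ ≤ i₀.natAbs := by omega
      have h2 : (1 : ℤ) * i₀.natAbs ≤ (2 * a + 1) * i₀.natAbs :=
        mul_le_mul_of_nonneg_right (by omega) (by positivity)
      omega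
  have key : ∀ t : ℕ, v (4 * (t * (a + 1)) + 1) = v (4 * (c - t * (a + 1))) := by
    intro t
    induction t with
    | zero => simpa using hc.symm
    | succ t ih =>
      have h1 := hup (t * (a + 1))
      rw [ih] at h1
      have h2 := hB _ _ _ h1 (hdown _)
      convert h2 using 2 <;> push_cast <;> ring
  -- Since 2(a + 1) = n + 1, the indices c(a + 1) and c − c(a + 1) agree mod n.
  refine ⟨v (4 * (c * (a + 1))), ?_⟩
  have h := hA (c * (a + 1))
  have e : v (4 * (c * (a + 1)) + 1) = v (4 * (c * (a + 1))) := by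
    rw [key c, ← hper c]
    congr 1
    ring
  rwa [e] at h

/-! ### Gaps of subsets of the line -/

/-- `a < b` are consecutive elements of `A`. -/
def IsGap (A : Set ℝ) (a b : ℝ) : Prop :=
  a ∈ A ∧ b ∈ A ∧ a < b ∧ ∀ t ∈ Ioo a b, t ∉ A

section Gap

variable {A : Set ℝ} {a b a' b' : ℝ}

theorem IsGap.right_unique (h : IsGap A a b) (h' : IsGap A a b') : b = b' := by
  obtain ⟨-, hb, hab, hg⟩ := h
  obtain ⟨-, hb', hab', hg'⟩ := h'
  rcases lt_trichotomy b b' with hlt | heq | hlt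
  · exact absurd hb (hg' b ⟨hab, hlt⟩)
  · exact heq
  · exact absurd hb' (hg b' ⟨hab', hlt⟩)

theorem IsGap.left_unique (h : IsGap A a b) (h' : IsGap A a' b) : a = a' := by
  obtain ⟨ha, -, hab, hg⟩ := h
  obtain ⟨ha', -, hab', hg'⟩ := h'
  rcases lt_trichotomy a a' with hlt | heq | hlt
  · exact absurd ha' (hg a' ⟨hlt, hab'⟩)
  · exact heq
  · exact absurd ha (hg' a ⟨hlt, hab⟩)

theorem IsGap.eq_of_mem (h : IsGap A a b) (h' : IsGap A a' b') {t : ℝ} (ht : t ∈ Ioo a b)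
    (ht' : t ∈ Ioo a' b') : a = a' ∧ b = b' := by
  have e : a = a' := by
    rcases lt_trichotomy a a' with hlt | heq | hlt
    · exact absurd h'.1 (h.2.2.2 a' ⟨hlt, ht'.1.trans ht.2⟩)
    · exact heq
    · exact absurd h.1 (h'.2.2.2 a ⟨hlt, ht.1.trans ht'.2⟩)
  subst e
  exact ⟨rfl, h.right_unique h'⟩

theorem IsGap.add_int (hA : ∀ (t : ℝ) (k : ℤ), t + k ∈ A ↔ t ∈ A) (h : IsGap A a b) (k : ℤ) :
    IsGap A (a + k) (b + k) := by
  refine ⟨(hA _ _).2 h.1, (hA _ _).2 h.2.1, by linarith [h.2.2.1], fun t ht hmem => ?_⟩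
  refine h.2.2.2 (t - k) ⟨by linarith [ht.1], by linarith [ht.2]⟩ ?_
  rw [← hA _ k]
  simpa using hmem

/-- Local finiteness provides a last point of `A` up to `b` at which `p` holds and, if this is not
`b`, a next point of `A`; the gap between them gives a contradiction. -/
theorem induction_isGap (hfin : ∀ x y, (A ∩ Icc x y).Finite) {p : ℝ → Prop}
    (hp : ∀ x y, IsGap A x y → p x → p y) (ha : a ∈ A) (hb : b ∈ A) (hab : a ≤ b) (h : p a) :
    p b := by
  by_contra hcon
  obtain ⟨t, ⟨⟨htA, hat, htb⟩, hpt⟩, hmax⟩ :=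
    ((hfin a b).subset (fun t ht => ht.1 : {t | t ∈ A ∩ Icc a b ∧ p t} ⊆ A ∩ Icc a b)).exists_maximalFor id _
      ⟨a, ⟨ha, le_rfl, hab⟩, h⟩
  have htb' : t < b := lt_of_le_of_ne htb (by rintro rfl; exact hcon hpt)
  obtain ⟨w, ⟨hwA, htw, hwb⟩, hmin⟩ :=
    ((hfin t b).subset (inter_subset_inter_right A Ioc_subset_Icc_self)).exists_minimalFor
      id _ ⟨b, hb, htb', le_rfl⟩
  have hgap : IsGap A t w := by
    refine ⟨htA, hwA, htw, fun r hr hrA => ?_⟩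
    have := hmin ⟨hrA, hr.1, hr.2.le.trans hwb⟩ hr.2.le
    exact absurd hr.2 (not_lt.2 this)
  have := hmax ⟨⟨hwA, hat.trans htw.le, hwb⟩, hp _ _ hgap hpt⟩ htw.le
  exact absurd htw (not_lt.2 this)

end Gap

variable [ChartedSpace (EuclideanSpace ℝ (Fin 2)) S]

theorem Curve.add_int (γ : Curve S) (t : ℝ) (k : ℤ) : γ.toFun (t + k) = γ.toFun t :=
  ((γ.simple.2 t (t + k)).2 ⟨k, rfl⟩).symm

/-! ### The cyclic order of crossings along a curve -/

/-- The parameters at which `γ` meets `δ`. -/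
def meetingTimes (γ δ : Curve S) : Set ℝ := {t | γ.toFun t ∈ δ.carrier}

theorem meetingTimes_add_int (γ δ : Curve S) (t : ℝ) (k : ℤ) :
    t + k ∈ meetingTimes γ δ ↔ t ∈ meetingTimes γ δ := by
  simp [meetingTimes, γ.add_int]

theorem finite_meetingTimes (γ δ : Curve S) (hfin : (γ.carrier ∩ δ.carrier).Finite) (x y : ℝ) :
    (meetingTimes γ δ ∩ Icc x y).Finite := by
  refine Set.Finite.of_finite_fibers γ.toFun (hfin.subset ?_) ?_
  · rintro _ ⟨t, ht, rfl⟩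
    exact ⟨⟨t, rfl⟩, ht.1⟩
  · rintro _ ⟨s, hs, rfl⟩
    refine ((Set.finite_Icc ⌈x - s⌉ ⌊y - s⌋).image (fun k : ℤ => s + k)).subset ?_
    rintro t ⟨⟨-, htx, hty⟩, ht⟩
    obtain ⟨k, rfl⟩ := (γ.simple.2 s t).1 (Eq.symm ht)
    exact ⟨k, ⟨Int.ceil_le.2 (by linarith), Int.le_floor.2 (by linarith)⟩, rfl⟩

/-- `y` is the first point of `δ` on `γ` after `x`. -/
def Next (γ δ : Curve S) (x y : S) : Prop :=
  ∃ a b, IsGap (meetingTimes γ δ) a b ∧ γ.toFun a = x ∧ γ.toFun b = y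

theorem Next.right_unique {γ δ : Curve S} {x y z : S} (h : Next γ δ x y) (h' : Next γ δ x z) :
    y = z := by
  obtain ⟨a, b, hg, rfl, rfl⟩ := h
  obtain ⟨a', b', hg', he, rfl⟩ := h'
  obtain ⟨k, rfl⟩ := (γ.simple.2 _ _).1 he
  have := (hg'.add_int (meetingTimes_add_int γ δ) k).right_unique hg
  rw [← this, γ.add_int]

theorem Next.left_unique {γ δ : Curve S} {x y z : S} (h : Next γ δ y x) (h' : Next γ δ z x) :
    y = z := by
  obtain ⟨a, b, hg, rfl, rfl⟩ := h
  obtain ⟨a', b', hg', rfl, he⟩ := h'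
  obtain ⟨k, rfl⟩ := (γ.simple.2 _ _).1 he
  have := (hg'.add_int (meetingTimes_add_int γ δ) k).left_unique hg
  rw [← this, γ.add_int]

/-- The successor map along a closed curve is transitive on the crossings: a parameter of `y`,
shifted by an integer to lie beyond that of `x`, is reached through finitely many gaps. -/
theorem Next.mem_of_mem {γ δ : Curve S} (hfin : (γ.carrier ∩ δ.carrier).Finite) {x y : S}
    (hx : x ∈ γ.carrier ∩ δ.carrier) (hy : y ∈ γ.carrier ∩ δ.carrier) (Y : Set S) (hxY : x ∈ Y)
    (hY : ∀ x ∈ Y, ∀ y, Next γ δ x y → y ∈ Y) : y ∈ Y := by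
  obtain ⟨⟨a, rfl⟩, ha⟩ := hx
  obtain ⟨⟨b, rfl⟩, hb⟩ := hy
  rw [← γ.add_int b ⌈a - b⌉]
  refine induction_isGap (A := meetingTimes γ δ) (p := fun t => γ.toFun t ∈ Y)
    (finite_meetingTimes γ δ hfin) (fun s t hg hs => hY _ hs _ ⟨s, t, hg, rfl, rfl⟩) ha
    ((meetingTimes_add_int _ _ _ _).2 hb) ?_ hxY
  linarith [Int.le_ceil (a - b)]

theorem Next.mem_of_mem_flip {γ δ : Curve S} (hfin : (γ.carrier ∩ δ.carrier).Finite) {x y : S}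
    (hx : x ∈ γ.carrier ∩ δ.carrier) (hy : y ∈ γ.carrier ∩ δ.carrier) (Y : Set S) (hxY : x ∈ Y)
    (hY : ∀ x ∈ Y, ∀ y, Next γ δ y x → y ∈ Y) : y ∈ Y := by
  by_contra hcon
  exact Next.mem_of_mem hfin hy hx Yᶜ hcon (fun z hz w hw hwY => hz (hY _ hwY _ hw)) hxY

/-- A curve through a single point of `δ` has only one gap up to translation. -/
theorem IsGap.image_eq_of_next_self {γ δ : Curve S} {x : S} (h : Next γ δ x x) {a b a' b' : ℝ}
    (hg : IsGap (meetingTimes γ δ) a b) (hg' : IsGap (meetingTimes γ δ) a' b') :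
    γ.toFun '' Ioo a b = γ.toFun '' Ioo a' b' := by
  obtain ⟨c, d, hcd, rfl, he⟩ := h
  obtain ⟨k, rfl⟩ := (γ.simple.2 _ _).1 he.symm
  have hk : (1 : ℤ) ≤ k := by
    have := hcd.2.2.1
    have : (0 : ℝ) < k := by linarith
    exact_mod_cast this
  -- A longer gap would contain the meeting time `c + 1`.
  have hk1 : k = 1 := by
    by_contra hne
    have h2 : (1 : ℝ) < k := by exact_mod_cast lt_of_le_of_ne hk (Ne.symm hne)
    refine hcd.2.2.2 (c + (1 : ℤ)) ⟨by simp, by simpa using h2⟩ ?_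
    exact (meetingTimes_add_int _ _ _ _).2 hcd.1
  subst hk1
  have main : ∀ a b : ℝ, IsGap (meetingTimes γ δ) a b →
      γ.toFun '' Ioo a b = γ.toFun '' Ioo c (c + (1 : ℤ)) := by
    intro a b hg
    obtain ⟨q, h1, h2⟩ : ∃ q : ℤ, (q : ℝ) ≤ a - c ∧ a - c < q + 1 :=
      ⟨⌊a - c⌋, Int.floor_le _, Int.lt_floor_add_one _⟩
    have hcq := hcd.add_int (meetingTimes_add_int γ δ) q
    have hac : a = c + q := by
      by_contra hne
      refine hcq.2.2.2 a ⟨lt_of_le_of_ne (by linarith) (Ne.symm hne), ?_⟩ hg.1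
      push_cast
      linarith
    subst hac
    rw [hg.right_unique hcq]
    ext y
    constructor
    · rintro ⟨t, ht, rfl⟩
      refine ⟨t + (-q : ℤ), ⟨?_, ?_⟩, γ.add_int _ _⟩
      · push_cast; linarith [ht.1]
      · have := ht.2
        push_cast at this ⊢; linarith
    · rintro ⟨t, ht, rfl⟩
      refine ⟨t + q, ⟨?_, ?_⟩, γ.add_int _ _⟩
      · linarith [ht.1]
      · linarith [ht.2]
  rw [main a b hg, main a' b' hg']

/-- Gaps with the same image on the curve have the same end points on the curve. -/
theorem IsGap.eq_of_image_eq {γ δ : Curve S} {a b a' b' : ℝ}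
    (hg : IsGap (meetingTimes γ δ) a b) (hg' : IsGap (meetingTimes γ δ) a' b')
    (h : γ.toFun '' Ioo a b = γ.toFun '' Ioo a' b') :
    γ.toFun a = γ.toFun a' ∧ γ.toFun b = γ.toFun b' := by
  have hmid : (a + b) / 2 ∈ Ioo a b := ⟨by linarith [hg.2.2.1], by linarith [hg.2.2.1]⟩
  obtain ⟨t, ht, hte⟩ := h.subset (mem_image_of_mem γ.toFun hmid)
  obtain ⟨k, hk⟩ := (γ.simple.2 _ _).1 hte
  obtain ⟨rfl, rfl⟩ := hg.eq_of_mem (hg'.add_int (meetingTimes_add_int γ δ) k) hmid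
    ⟨by rw [hk]; linarith [ht.1], by rw [hk]; linarith [ht.2]⟩
  exact ⟨γ.add_int _ _, γ.add_int _ _⟩

/-! ### Lifting arcs to the parameter line -/

/-- Paths on a simple closed curve lift to the parameter line. -/
theorem Curve.exists_lift [T2Space S] (γ : Curve S) {c : ℝ → S} (hc : ContinuousOn c (Icc 0 1))
    (hmem : ∀ t ∈ Icc (0 : ℝ) 1, c t ∈ γ.carrier) :
    ∃ f : ℝ → ℝ, Continuous f ∧ ∀ t ∈ Icc (0 : ℝ) 1, γ.toFun (f t) = c t := by
  have : Fact ((0 : ℝ) < 1) := ⟨one_pos⟩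
  have hperiodic : Function.Periodic γ.toFun (1 : ℝ) := fun t => by
    simpa using γ.add_int t 1
  set G : AddCircle (1 : ℝ) → S := hperiodic.lift with hG
  -- The curve is an embedded circle, so the path factors through `AddCircle` and lifts along its
  -- covering by ℝ.
  have hGcoe : ∀ t : ℝ, G (t : AddCircle (1 : ℝ)) = γ.toFun t := fun t =>
    hperiodic.lift_coe t
  have hGc : Continuous G := γ.simple.1.quotient_lift _
  have hGi : Function.Injective G := by
    intro x y
    induction x using QuotientAddGroup.induction_on with | _ s
    induction y using QuotientAddGroup.induction_on with | _ t
    intro h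
    rw [hGcoe, hGcoe] at h
    obtain ⟨k, rfl⟩ := (γ.simple.2 _ _).1 h
    exact QuotientAddGroup.eq.2 (AddSubgroup.mem_zmultiples_iff.2 ⟨k, by simp⟩)
  have hGemb : Topology.IsClosedEmbedding G := hGc.isClosedEmbedding hGi
  have hrange : ∀ t ∈ Icc (0 : ℝ) 1, c t ∈ range G := by
    intro t ht
    obtain ⟨s, hs⟩ := hmem t ht
    exact ⟨s, (hGcoe s).trans hs⟩
  choose! p hp using hrange
  have hpc : Continuous fun t : unitInterval => p t := by
    rw [hGemb.isEmbedding.continuous_iff]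
    refine (continuousOn_iff_continuous_domRestrict.1 hc).congr fun t => (hp t t.2).symm
  obtain ⟨e, he⟩ := QuotientAddGroup.mk_surjective (p 0)
  obtain ⟨Γ, hΓ, -⟩ := (AddCircle.isCoveringMap_coe (1 : ℝ)).exists_path_lifts ⟨_, hpc⟩ e he.symm
  refine ⟨IccExtend zero_le_one Γ, Γ.continuous.Icc_extend', fun t ht => ?_⟩
  rw [IccExtend_of_mem _ _ ht, ← hGcoe, ← hp t ht]
  exact congrArg G (congrFun hΓ ⟨t, ht⟩)

/-- A continuous function that is strictly monotone on the open unit interval and maps exactly the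
end points of that interval to `A` runs through a gap of `A`. -/
theorem isGap_of_strictMonoOn {A : Set ℝ} {f : ℝ → ℝ} (hf : Continuous f)
    (hmono : StrictMonoOn f (Ioo 0 1)) (h₀ : f 0 ∈ A) (h₁ : f 1 ∈ A)
    (hA : ∀ t ∈ Ioo (0 : ℝ) 1, f t ∉ A) :
    IsGap A (f 0) (f 1) ∧ f '' Ioo 0 1 = Ioo (f 0) (f 1) := by
  have hl : ∀ t ∈ Ioo (0 : ℝ) 1, f 0 < f t := by
    intro t ht
    refine lt_of_le_of_ne ?_ fun h => hA t ht (h ▸ h₀)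
    refine le_of_tendsto (hf.continuousWithinAt (s := Ioi 0) (x := 0)) ?_
    filter_upwards [Ioo_mem_nhdsGT ht.1] with s hs
    exact (hmono ⟨hs.1, hs.2.trans ht.2⟩ ht hs.2).le
  have hr : ∀ t ∈ Ioo (0 : ℝ) 1, f t < f 1 := by
    intro t ht
    refine lt_of_le_of_ne ?_ fun h => hA t ht (h ▸ h₁)
    refine ge_of_tendsto (hf.continuousWithinAt (s := Iio 1) (x := 1)) ?_
    filter_upwards [Ioo_mem_nhdsLT ht.2] with s hs
    exact (hmono ht ⟨ht.1.trans hs.1, hs.2⟩ hs.1).le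
  have himage : f '' Ioo 0 1 = Ioo (f 0) (f 1) :=
    Subset.antisymm (image_subset_iff.2 fun t ht => ⟨hl t ht, hr t ht⟩)
      (intermediate_value_Ioo zero_le_one hf.continuousOn)
  have hhalf : (1 / 2 : ℝ) ∈ Ioo (0 : ℝ) 1 := by norm_num
  refine ⟨⟨h₀, h₁, (hl _ hhalf).trans (hr _ hhalf), fun x hx => ?_⟩, himage⟩
  rw [← himage] at hx
  obtain ⟨t, ht, rfl⟩ := hx
  exact hA t ht

/-- Paths on a curve `γ` between consecutive points of `δ` lift to monotone paths through a gap. -/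
theorem Curve.exists_lift_isGap [T2Space S] (γ δ : Curve S) {c : ℝ → S}
    (hc : ContinuousOn c (Icc 0 1)) (hinj : InjOn c (Ioo 0 1)) (hmem : MapsTo c (Icc 0 1) γ.carrier)
    (hnot : ∀ t ∈ Ioo (0 : ℝ) 1, c t ∉ δ.carrier) (h₀ : c 0 ∈ δ.carrier) (h₁ : c 1 ∈ δ.carrier) :
    ∃ f : ℝ → ℝ, Continuous f ∧ (∀ t ∈ Icc (0 : ℝ) 1, γ.toFun (f t) = c t) ∧
      ((IsGap (meetingTimes γ δ) (f 0) (f 1) ∧ (∀ t ∈ Ioo (0 : ℝ) 1, f t ∈ Ioo (f 0) (f 1)) ∧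
        c '' Ioo 0 1 = γ.toFun '' Ioo (f 0) (f 1)) ∨
      (IsGap (meetingTimes γ δ) (f 1) (f 0) ∧ (∀ t ∈ Ioo (0 : ℝ) 1, f t ∈ Ioo (f 1) (f 0)) ∧
        c '' Ioo 0 1 = γ.toFun '' Ioo (f 1) (f 0))) := by
  obtain ⟨f, hf, hfc⟩ := γ.exists_lift hc hmem
  have hfc' : ∀ t ∈ Ioo (0 : ℝ) 1, γ.toFun (f t) = c t := fun t ht =>
    hfc t (Ioo_subset_Icc_self ht)
  refine ⟨f, hf, hfc, ?_⟩
  have himage : c '' Ioo 0 1 = γ.toFun '' (f '' Ioo 0 1) := by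
    rw [image_image]
    exact image_congr fun t ht => (hfc' t ht).symm
  have hfinj : InjOn f (Ioo 0 1) := fun s hs t ht h => hinj hs ht (by
    rw [← hfc' s hs, ← hfc' t ht, h])
  have h₀' : f 0 ∈ meetingTimes γ δ := by simpa [meetingTimes, hfc] using h₀
  have h₁' : f 1 ∈ meetingTimes γ δ := by simpa [meetingTimes, hfc] using h₁
  have hnot' : ∀ t ∈ Ioo (0 : ℝ) 1, f t ∉ meetingTimes γ δ := fun t ht => by
    simpa [meetingTimes, hfc' t ht] using hnot t ht
  rcases hf.continuousOn.strictMonoOn_of_injOn_Ioo (zero_lt_one' ℝ) hfinj with hmono | hanti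
  · obtain ⟨hg, hi⟩ := isGap_of_strictMonoOn hf hmono h₀' h₁' hnot'
    exact Or.inl ⟨hg, fun t ht => hi.subset (mem_image_of_mem f ht), by rw [himage, hi]⟩
  · have hmaps : ∀ t ∈ Ioo (0 : ℝ) 1, 1 - t ∈ Ioo (0 : ℝ) 1 := fun t ht =>
      ⟨by linarith [ht.2], by linarith [ht.1]⟩
    have hrev : f '' Ioo 0 1 = (fun t => f (1 - t)) '' Ioo 0 1 := by
      ext x
      constructor
      · rintro ⟨t, ht, rfl⟩
        exact ⟨1 - t, hmaps t ht, by simp⟩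
      · rintro ⟨t, ht, rfl⟩
        exact ⟨1 - t, hmaps t ht, rfl⟩
    obtain ⟨hg, hi⟩ := isGap_of_strictMonoOn (f := fun t => f (1 - t)) (by fun_prop)
      (fun s hs t ht hst => hanti (hmaps t ht) (hmaps s hs) (by linarith))
      (by simpa using h₁') (by simpa using h₀') (fun t ht => hnot' _ (hmaps t ht))
    rw [← hrev] at hi
    simp only [sub_zero, sub_self] at hg hi
    exact Or.inr ⟨hg, fun t ht => hi.subset (mem_image_of_mem f ht), by rw [himage, hi]⟩

/-! ### Determinants in the plane -/

theorem det₂_smul_smul (a b : ℝ) (v w : EuclideanSpace ℝ (Fin 2)) :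
    det₂ (a • v) (b • w) = a * b * det₂ v w := by
  simp [det₂]
  ring

theorem det₂_swap (v w : EuclideanSpace ℝ (Fin 2)) : det₂ w v = -det₂ v w := by
  simp [det₂]
  ring

theorem det₂_smul_same (a b : ℝ) (v : EuclideanSpace ℝ (Fin 2)) : det₂ (a • v) (b • v) = 0 := by
  simp [det₂]
  ring

theorem det₂_complex (M : ℂ →L[ℝ] EuclideanSpace ℝ (Fin 2)) (z w : ℂ) :
    det₂ (M z) (M w) = (z.re * w.im - z.im * w.re) * det₂ (M 1) (M Complex.I) := by
  have h : ∀ z : ℂ, M z = z.re • M 1 + z.im • M Complex.I := by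
    intro z
    rw [← map_smul, ← map_smul, ← map_add]
    congr 1
    apply Complex.ext <;> simp
  rw [h z, h w]
  simp [det₂]
  ring

theorem det₂_map (T : EuclideanSpace ℝ (Fin 2) →L[ℝ] EuclideanSpace ℝ (Fin 2))
    (v w : EuclideanSpace ℝ (Fin 2)) : det₂ (T v) (T w) = T.det * det₂ v w := by
  set b := EuclideanSpace.basisFun (Fin 2) ℝ
  have hdet : T.det = (T (b 0)) 0 * (T (b 1)) 1 - (T (b 1)) 0 * (T (b 0)) 1 := by
    rw [ContinuousLinearMap.det, ← LinearMap.det_toMatrix b.toBasis, Matrix.det_fin_two]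
    simp [LinearMap.toMatrix_apply, b]
  have h : ∀ z : EuclideanSpace ℝ (Fin 2), T z = z 0 • T (b 0) + z 1 • T (b 1) := by
    intro z
    rw [← T.map_smul, ← T.map_smul, ← T.map_add]
    congr 1
    ext i
    fin_cases i <;> simp [b]
  rw [h v, h w, hdet]
  simp [det₂]
  ring

/-- If the determinant vanishes, the combination of 1 and `I` with coefficients `M I i` and `-M 1 i`
lies in the kernel for each `i`; injectivity then gives `M 1 = 0`. -/
theorem det₂_ne_zero_of_injective {M : ℂ →L[ℝ] EuclideanSpace ℝ (Fin 2)}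
    (hM : Function.Injective M) : det₂ (M 1) (M Complex.I) ≠ 0 := by
  intro h
  have key : ∀ i, (M ((M Complex.I i : ℝ) • (1 : ℂ) - (M 1 i : ℝ) • Complex.I)) = 0 := by
    intro i
    rw [map_sub, map_smul, map_smul]
    simp only [det₂] at h
    ext j
    fin_cases i <;> fin_cases j <;> simp <;> linarith
  have hz : ∀ i, M 1 i = 0 := by
    intro i
    have h0 := hM ((key i).trans (map_zero M).symm)
    simpa using congrArg Complex.im h0
  have h1 : M 1 = 0 := by
    ext i
    simpa using hz i
  exact one_ne_zero (hM (h1.trans (map_zero M).symm))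

/-! ### Tangent directions of lifted paths -/

section Ray

open Filter Topology

/-- If a path starting at `0` runs forwards on a regular curve, its velocity is a nonnegative
multiple of that of the curve. -/
theorem exists_nonneg_smul_of_lift {E : Type*} [NormedAddCommGroup E] [InnerProductSpace ℝ E]
    {γ c : ℝ → E} {f : ℝ → ℝ} {w u : E} (hγ : HasDerivAt γ w (f 0))
    (hc : HasDerivWithinAt c u (Ioi 0) 0) (hf : ContinuousAt f 0)
    (h : ∀ᶠ t in 𝓝[>] (0 : ℝ), γ (f t) = c t) (h₀ : γ (f 0) = c 0)
    (hpos : ∀ᶠ t in 𝓝[>] (0 : ℝ), f 0 < f t) (hw : w ≠ 0) : ∃ r : ℝ, 0 ≤ r ∧ u = r • w := by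
  have hc' : Tendsto (slope c 0) (𝓝[>] 0) (𝓝 u) :=
    (hasDerivWithinAt_iff_tendsto_slope' self_notMem_Ioi).1 hc
  have hft : Tendsto f (𝓝[>] 0) (𝓝[≠] (f 0)) :=
    tendsto_nhdsWithin_iff.2 ⟨hf.tendsto.mono_left nhdsWithin_le_nhds,
      hpos.mono fun t ht => ne_of_gt ht⟩
  have hγ' : Tendsto (fun t => slope γ (f 0) (f t)) (𝓝[>] 0) (𝓝 w) := hγ.tendsto_slope.comp hft
  set ρ : ℝ → ℝ := fun t => (f t - f 0) / t with hρ
  have heq : ∀ᶠ t in 𝓝[>] (0 : ℝ), slope c 0 t = ρ t • slope γ (f 0) (f t) := by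
    filter_upwards [h, hpos, self_mem_nhdsWithin] with t h1 h2 h3
    have h3' : t ≠ 0 := ne_of_gt h3
    have h2' : f t - f 0 ≠ 0 := by linarith
    simp only [slope, vsub_eq_sub, sub_zero, ← h1, ← h₀, hρ, smul_smul]
    congr 1
    field_simp
  have hinner : Tendsto (fun t => inner ℝ w (slope γ (f 0) (f t))) (𝓝[>] 0) (𝓝 (inner ℝ w w)) :=
    tendsto_const_nhds.inner hγ'
  have hww : inner ℝ w w ≠ 0 := inner_self_ne_zero.2 hw
  -- `f` is only continuous, so the limit of its difference quotient is extracted by pairing both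
  -- slopes with `w`.
  have hρt : Tendsto ρ (𝓝[>] 0) (𝓝 (inner ℝ w u / inner ℝ w w)) := by
    refine ((tendsto_const_nhds.inner hc').div hinner hww).congr' ?_
    filter_upwards [heq, hinner.eventually_ne hww] with t h1 h2
    rw [Pi.div_apply, h1, inner_smul_right]
    field_simp
  refine ⟨_, ge_of_tendsto hρt ?_, tendsto_nhds_unique (hc'.congr' heq) (hρt.smul hγ')⟩
  filter_upwards [hpos, self_mem_nhdsWithin] with t h1 h2
  exact div_nonneg (by linarith) (le_of_lt h2)

end Ray

theorem Curve.hasDerivAt_chart (γ : Curve S) {t : ℝ} {p : S} (hp : γ.toFun t = p) :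
    HasDerivAt (fun s => chartAt (EuclideanSpace ℝ (Fin 2)) p (γ.toFun s))
      (velocity γ.toFun t) t := by
  subst hp
  obtain ⟨M, hM⟩ : ∃ M : ℝ →L[ℝ] EuclideanSpace ℝ (Fin 2),
      M = mfderiv 𝓘(ℝ, ℝ) (𝓡 2) γ.toFun t := ⟨_, rfl⟩
  have hv : velocity γ.toFun t = M 1 := by rw [hM]; rfl
  have h := ((γ.smooth t).mdifferentiableAt (by simp)).hasMFDerivAt.2
  rw [← hM] at h
  have h' : HasFDerivWithinAt
      (fun s => chartAt (EuclideanSpace ℝ (Fin 2)) (γ.toFun t) (γ.toFun s)) M univ t := by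
    simpa only [writtenInExtChartAt, Function.comp_def, mfld_simps] using! h
  rw [hv]
  exact (hasFDerivWithinAt_univ.1 h').hasDerivAt

theorem Curve.velocity_add_int (γ : Curve S) (t : ℝ) (k : ℤ) :
    velocity γ.toFun (t + k) = velocity γ.toFun t := by
  have h := (γ.hasDerivAt_chart (γ.add_int t k)).comp_add_const t (k : ℝ)
  simp only [γ.add_int] at h
  exact h.unique (γ.hasDerivAt_chart rfl)

/-- The derivative of `P` within `K` at `z`, in the coordinates of the preferred chart at `P z`. -/
def tangentMap (P : ℂ → S) (K : Set ℂ) (z : ℂ) : ℂ →L[ℝ] EuclideanSpace ℝ (Fin 2) :=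
  mfderivWithin 𝓘(ℝ, ℂ) (𝓡 2) P K z

theorem hasFDerivWithinAt_chart {P : ℂ → S} {K : Set ℂ}
    (hP : ContMDiffOn 𝓘(ℝ, ℂ) (𝓡 2) 1 P K) {z : ℂ} (hz : z ∈ K) :
    HasFDerivWithinAt (fun y => chartAt (EuclideanSpace ℝ (Fin 2)) (P z) (P y))
      (tangentMap P K z) K z := by
  have h := ((hP z hz).mdifferentiableWithinAt (by simp)).hasMFDerivWithinAt.2
  simpa [writtenInExtChartAt, Function.comp_def] using! h

/-- The derivative of a map to the surface along a segment that is mapped to a curve. -/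
theorem Curve.exists_pos_smul (γ : Curve S) {P : ℂ → S} {K : Set ℂ} (hK : Convex ℝ K)
    (hP : ContMDiffOn 𝓘(ℝ, ℂ) (𝓡 2) 1 P K)
    {z w : ℂ} (hz : z ∈ K) (hw : w ∈ K) (hzw : z ≠ w)
    (hreg : Function.Injective (tangentMap P K z))
    {f : ℝ → ℝ} (hf : Continuous f)
    (hlift : ∀ t ∈ Icc (0 : ℝ) 1, γ.toFun (f t) = P (z + t • (w - z)))
    {ε : ℝ} (hε : ε * ε = 1) (hpos : ∀ t ∈ Ioo (0 : ℝ) 1, 0 < ε * (f t - f 0)) :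
    ∃ r : ℝ, 0 < r ∧ (tangentMap P K z) (w - z)
      = (ε * r) • velocity γ.toFun (f 0) := by
  have h0 : γ.toFun (f 0) = P z := by simpa using hlift 0 (by simp)
  set M : ℂ →L[ℝ] EuclideanSpace ℝ (Fin 2) := tangentMap P K z with hM
  have hγ := γ.hasDerivAt_chart h0
  have hc : HasDerivWithinAt
      (fun t : ℝ => chartAt (EuclideanSpace ℝ (Fin 2)) (P z) (P (z + t • (w - z))))
      (M (w - z)) (Icc 0 1) 0 := by
    have h1 : HasDerivWithinAt (fun t : ℝ => z + t • (w - z)) (w - z) (Icc 0 1) 0 := by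
      simpa using (((hasDerivAt_id (0 : ℝ)).smul_const (w - z)).const_add z).hasDerivWithinAt
    have h2 := hasFDerivWithinAt_chart hP hz
    have h3 : HasFDerivWithinAt (fun y => chartAt (EuclideanSpace ℝ (Fin 2)) (P z) (P y)) M K
      (z + (0 : ℝ) • (w - z)) := by simpa using h2
    exact h3.comp_hasDerivWithinAt 0 h1 fun t ht => hK.add_smul_sub_mem hz hw ht
  have hIcc : Icc (0 : ℝ) 1 ∈ nhdsWithin 0 (Ioi 0) :=
    Filter.mem_of_superset (Ioo_mem_nhdsGT one_pos) Ioo_subset_Icc_self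
  -- Precomposing with multiplication by `ε = ±1` reduces backward motion to forward motion.
  have hγε : HasDerivAt
      (fun s => chartAt (EuclideanSpace ℝ (Fin 2)) (P z) (γ.toFun (ε * s)))
      (ε • velocity γ.toFun (f 0)) (ε * f 0) := by
    have h1 : HasDerivAt (fun s : ℝ => ε * s) ε (ε * f 0) := by
      simpa using (hasDerivAt_id (ε * f 0)).const_mul ε
    have h2 : HasDerivAt (fun s => chartAt (EuclideanSpace ℝ (Fin 2)) (P z) (γ.toFun s))
        (velocity γ.toFun (f 0)) (ε * (ε * f 0)) := by rwa [← mul_assoc, hε, one_mul]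
    exact HasDerivAt.scomp (ε * f 0) h2 h1
  have hε0 : ε ≠ 0 := by rintro rfl; simp at hε
  obtain ⟨r, hr, hu⟩ := exists_nonneg_smul_of_lift (f := fun t => ε * f t) hγε
    (hc.mono_of_mem_nhdsWithin hIcc) (by fun_prop)
    (by
      filter_upwards [hIcc] with t ht
      rw [← mul_assoc, hε, one_mul, hlift t ht])
    (by simp [← mul_assoc, hε, h0])
    (by
      filter_upwards [Ioo_mem_nhdsGT one_pos] with t ht
      have := hpos t ht
      linarith)
    (smul_ne_zero hε0 (γ.regular _))
  refine ⟨r, lt_of_le_of_ne hr ?_, by rw [hu, smul_smul, mul_comm]⟩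
  rintro rfl
  rw [zero_smul] at hu
  exact hzw (sub_eq_zero.1 (hreg (hu.trans (map_zero M).symm))).symm

/-! ### Constancy of the orientation sign -/

section Orientation

open Filter Topology

/-- The preferred chart at `P y` jumps with `y`, so `J` need not be continuous. In the fixed chart
at `P z` the determinant is continuous, and the change of charts multiplies it by a positive factor
because the atlas is oriented. -/
theorem eventually_det₂_mul_pos [IsManifold (𝓡 2) ∞ S] (hor : IsOriented S) {P : ℂ → S} {K : Set ℂ}
    (hK : UniqueDiffOn ℝ K) (hP : ContMDiffOn 𝓘(ℝ, ℂ) (𝓡 2) 1 P K) {J : ℂ → ℝ}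
    (hJ : ∀ z, J z = det₂
      ((tangentMap P K z) 1)
      ((tangentMap P K z) Complex.I))
    {z : ℂ} (hz : z ∈ K) (hJz : J z ≠ 0) : ∀ᶠ y in 𝓝[K] z, 0 < J z * J y := by
  set e := chartAt (EuclideanSpace ℝ (Fin 2)) (P z)
  set F : ℂ → EuclideanSpace ℝ (Fin 2) := fun y => e (P y) with hF
  have hFz : fderivWithin ℝ F K z = tangentMap P K z :=
    (hasFDerivWithinAt_chart hP hz).fderivWithin (hK z hz)
  have hFc : ContDiffWithinAt ℝ 1 F K z := by
    have := (contMDiffWithinAt_iff.1 (hP z hz)).2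
    simpa [Function.comp_def] using! this
  have hcont : ContinuousWithinAt (fderivWithin ℝ F K) K z :=
    (hFc.fderivWithin_right hK (m := 0) (by simp) hz).continuousWithinAt
  set G : ℂ → ℝ := fun y => det₂ (fderivWithin ℝ F K y 1) (fderivWithin ℝ F K y Complex.I) with hG
  have hGc : ContinuousWithinAt G K z := by
    have h : ∀ v : ℂ, ContinuousWithinAt (fun y => fderivWithin ℝ F K y v) K z := fun v =>
      hcont.clm_apply continuousWithinAt_const
    have h' : ∀ (v : ℂ) (i : Fin 2), ContinuousWithinAt (fun y => fderivWithin ℝ F K y v i) K z :=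
      fun v i => (EuclideanSpace.proj (𝕜 := ℝ) i).continuous.continuousAt.comp_continuousWithinAt (h v)
    exact ((h' _ _).mul (h' _ _)).sub ((h' _ _).mul (h' _ _))
  have hGz : G z = J z := by rw [hJ, hG]; simp only [hFz]
  have hGpos : ∀ᶠ y in 𝓝[K] z, 0 < J z * G y := by
    have : ContinuousWithinAt (fun y => J z * G y) K z := continuousWithinAt_const.mul hGc
    refine this.eventually (lt_mem_nhds ?_)
    beta_reduce
    rw [hGz]
    exact mul_self_pos.2 hJz
  have hdiff : ∀ᶠ y in 𝓝[K] z, DifferentiableWithinAt ℝ F K y := by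
    have := hFc.eventually (by simp)
    rw [insert_eq_of_mem hz] at this
    exact this.mono fun y hy => hy.differentiableWithinAt (by simp)
  have hsrc : ∀ᶠ y in 𝓝[K] z, P y ∈ e.source :=
    (hP z hz).continuousWithinAt.eventually
      (e.open_source.mem_nhds (mem_chart_source _ (P z)))
  filter_upwards [hGpos, hdiff, hsrc, self_mem_nhdsWithin] with y h1 h2 h3 hy
  set e' := chartAt (EuclideanSpace ℝ (Fin 2)) (P y) with he'
  have hx : e (P y) ∈ (e.symm.trans e').source := by
    simp [e.map_source h3, e.left_inv h3, he']
  have hpos : 0 < (fderiv ℝ (e.symm.trans e') (e (P y))).det :=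
    hor e (chart_mem_atlas _ _) e' (chart_mem_atlas _ _) _ hx
  have hTd : DifferentiableAt ℝ (e.symm.trans e') (e (P y)) := by
    have h := contDiffWithinAt_ext_coord_change (I := 𝓡 2) (n := ∞) (P y) (P z) (y := e (P y))
      (by simpa [ext_coord_change_source] using hx)
    have h' : ContDiffAt ℝ ∞ (e.symm.trans e') (e (P y)) := by
      simpa [contDiffWithinAt_univ] using! h
    exact h'.differentiableAt (by simp)
  have hcomp : HasFDerivWithinAt (fun x => e' (P x))
      ((fderiv ℝ (e.symm.trans e') (e (P y))).comp (fderivWithin ℝ F K y)) K y := by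
    have h := hTd.hasFDerivAt.comp_hasFDerivWithinAt y h2.hasFDerivWithinAt
    refine h.congr_of_eventuallyEq ?_ (by simp [hF, e.left_inv h3])
    filter_upwards [(hP y hy).continuousWithinAt.eventually (e.open_source.mem_nhds h3)] with x hx
    simp [hF, e.left_inv hx]
  have heq := (hK y hy).eq (hasFDerivWithinAt_chart hP hy) hcomp
  have hJy : J y = (fderiv ℝ (e.symm.trans e') (e (P y))).det * G y := by
    rw [hJ, hG]
    simp only [heq, ContinuousLinearMap.comp_apply]
    exact det₂_map _ _ _
  rw [hJy]
  nlinarith [mul_pos hpos h1]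

/-- The sign of the Jacobian determinant of a regular map to the surface is constant on a connected
set. -/
theorem exists_forall_mul_det₂_pos [IsManifold (𝓡 2) ∞ S] (hor : IsOriented S) {P : ℂ → S}
    {K : Set ℂ} (hK : UniqueDiffOn ℝ K) (hconn : IsPreconnected K)
    (hP : ContMDiffOn 𝓘(ℝ, ℂ) (𝓡 2) 1 P K)
    (hreg : ∀ z ∈ K, Function.Injective (tangentMap P K z)) :
    ∃ s : ℝ, ∀ z ∈ K, 0 < s * det₂
      ((tangentMap P K z) 1)
      ((tangentMap P K z) Complex.I) := by
  rcases K.eq_empty_or_nonempty with rfl | ⟨z₀, hz₀⟩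
  · exact ⟨1, fun z hz => hz.elim⟩
  set J : ℂ → ℝ := fun z => det₂
      ((tangentMap P K z) 1)
      ((tangentMap P K z) Complex.I)
  refine ⟨J z₀, fun z hz => ?_⟩
  have hJ0 : ∀ z ∈ K, J z ≠ 0 := fun z hz => det₂_ne_zero_of_injective (hreg z hz)
  refine hconn.induction₂ (fun x y => 0 < J x * J y) (fun x hx => ?_) (fun x y w hx hy hw h1 h2 => ?_)
    (fun x y hx hy h => ?_) hz₀ hz
  · exact eventually_det₂_mul_pos hor hK hP (fun _ => rfl) hx (hJ0 x hx)
  · have := mul_pos h1 h2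
    have hy2 := mul_self_pos.2 (hJ0 y hy)
    by_contra hcon
    nlinarith
  · linarith [mul_comm (J x) (J y)]

end Orientation

/-! ### The regular polygon -/

section Polygon

variable {m : ℕ}

theorem vertex_add_mul (hm : m ≠ 0) (k q : ℤ) : vertex m (k + q * m) = vertex m k := by
  have hm' : (m : ℂ) ≠ 0 := by exact_mod_cast hm
  rw [vertex, vertex, Complex.exp_eq_exp_iff_exists_int]
  refine ⟨q, ?_⟩
  push_cast
  field_simp

theorem side_add_mul (hm : m ≠ 0) (k q : ℤ) : side m (k + q * m) = side m k := by
  rw [side, side, vertex_add_mul hm, add_right_comm, vertex_add_mul hm]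

theorem vertex_eq_cos_add_sin (k : ℤ) :
    vertex m k = ⟨Real.cos (2 * Real.pi / m * k), Real.sin (2 * Real.pi / m * k)⟩ := by
  have h : (2 * Real.pi * Complex.I * (k : ℂ) / (m : ℂ)) =
      ((2 * Real.pi / m * k : ℝ) : ℂ) * Complex.I := by
    push_cast
    ring
  rw [vertex, h]
  apply Complex.ext
  · rw [Complex.exp_ofReal_mul_I_re]
  · rw [Complex.exp_ofReal_mul_I_im]

/-- The polygon turns left at each vertex. -/
theorem cross_sides_pos (hm : 3 ≤ m) (k : ℤ) :
    0 < (vertex m (k + 1) - vertex m k).re * (vertex m (k + 1 + 1) - vertex m (k + 1)).im -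
      (vertex m (k + 1) - vertex m k).im * (vertex m (k + 1 + 1) - vertex m (k + 1)).re := by
  set φ : ℝ := 2 * Real.pi / m with hφ
  set θ : ℝ := φ * (k + 1) with hθ
  have hm' : (3 : ℝ) ≤ m := by exact_mod_cast hm
  have hφ0 : 0 < φ := by positivity
  have hφπ : φ < Real.pi := by
    rw [hφ, div_lt_iff₀ (by linarith)]
    nlinarith [Real.pi_pos]
  have hs := Real.sin_pos_of_pos_of_lt_pi hφ0 hφπ
  have hc : Real.cos φ < 1 := by nlinarith [Real.sin_sq_add_cos_sq φ, Real.cos_le_one φ]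
  have h₀ : φ * (k : ℝ) = θ - φ := by rw [hθ]; ring
  have h₁ : φ * ((k + 1 : ℤ) : ℝ) = θ := by rw [hθ]; push_cast; ring
  have h₂ : φ * ((k + 1 + 1 : ℤ) : ℝ) = θ + φ := by rw [hθ]; push_cast; ring
  simp only [vertex_eq_cos_add_sin, ← hφ, h₀, h₁, h₂, Complex.sub_re, Complex.sub_im,
    Real.cos_sub, Real.sin_sub, Real.cos_add, Real.sin_add]
  have key : 0 < 2 * Real.sin φ * (1 - Real.cos φ) := by
    have : 0 < 1 - Real.cos φ := by linarith
    positivity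
  have hθ2 := Real.sin_sq_add_cos_sq θ
  calc (0 : ℝ) < (Real.sin θ ^ 2 + Real.cos θ ^ 2) * (2 * Real.sin φ * (1 - Real.cos φ)) := by
        rw [hθ2, one_mul]; exact key
    _ = _ := by ring

theorem vertex_ne_vertex_add_one (hm : 3 ≤ m) (k : ℤ) : vertex m k ≠ vertex m (k + 1) := by
  intro h
  have := cross_sides_pos hm k
  simp [← h] at this

theorem vertex_mem_polygon (k : ℤ) : vertex m k ∈ polygon m :=
  subset_convexHull ℝ _ ⟨k, rfl⟩

theorem convex_polygon : Convex ℝ (polygon m) := convex_convexHull ℝ _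

theorem uniqueDiffOn_polygon (hm : 3 ≤ m) : UniqueDiffOn ℝ (polygon m) := by
  refine uniqueDiffOn_convex convex_polygon ?_
  rw [polygon, interior_convexHull_nonempty_iff_affineSpan_eq_top,
    AffineSubspace.affineSpan_eq_top_iff_vectorSpan_eq_top_of_nonempty ℝ ℂ ℂ (range_nonempty _),
    Submodule.eq_top_iff']
  intro x
  have hu : vertex m (0 + 1) - vertex m 0 ∈ vectorSpan ℝ (range (vertex m)) :=
    vsub_mem_vectorSpan ℝ ⟨_, rfl⟩ ⟨_, rfl⟩
  have hw : vertex m (0 + 1 + 1) - vertex m (0 + 1) ∈ vectorSpan ℝ (range (vertex m)) :=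
    vsub_mem_vectorSpan ℝ ⟨_, rfl⟩ ⟨_, rfl⟩
  have hcross := (cross_sides_pos hm 0).ne'
  set u := vertex m (0 + 1) - vertex m 0
  set w := vertex m (0 + 1 + 1) - vertex m (0 + 1)
  -- Cramer's rule: two consecutive edge vectors span the plane.
  have hx : x = ((x.re * w.im - x.im * w.re) / (u.re * w.im - u.im * w.re)) • u +
      ((u.re * x.im - u.im * x.re) / (u.re * w.im - u.im * w.re)) • w := by
    apply Complex.ext
    · simp only [Complex.add_re, Complex.real_smul, Complex.re_ofReal_mul]
      rw [div_mul_eq_mul_div, div_mul_eq_mul_div, ← add_div, eq_div_iff hcross]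
      ring
    · simp only [Complex.add_im, Complex.real_smul, Complex.im_ofReal_mul]
      rw [div_mul_eq_mul_div, div_mul_eq_mul_div, ← add_div, eq_div_iff hcross]
      ring
  rw [hx]
  exact add_mem (Submodule.smul_mem _ _ hu) (Submodule.smul_mem _ _ hw)

theorem side_eq_image (k : ℤ) :
    side m k = (fun t : ℝ => vertex m k + t • (vertex m (k + 1) - vertex m k)) '' Ioo 0 1 :=
  openSegment_eq_image' ℝ _ _

end Polygon

/-! ### Sides as directed arcs -/

/-- The `k`-th side of the `m`-gon runs on `γ` from the parameter `a` to the parameter `b`, which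
are consecutive meeting times with `δ`; `ε = 1` if it runs forwards and `ε = -1` if it runs
backwards. -/
structure IsSideLift (γ δ : Curve S) (m : ℕ) (P : ℂ → S) (k : ℤ) (ε a b : ℝ) : Prop where
  map_left : γ.toFun a = P (vertex m k)
  map_right : γ.toFun b = P (vertex m (k + 1))
  velocity_left : ∃ r : ℝ, 0 < r ∧ tangentMap P (polygon m) (vertex m k)
    (vertex m (k + 1) - vertex m k) = (ε * r) • velocity γ.toFun a
  velocity_right : ∃ r : ℝ, 0 < r ∧ tangentMap P (polygon m) (vertex m (k + 1))
    (vertex m (k + 1) - vertex m k) = (ε * r) • velocity γ.toFun b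
  isGap : (ε = 1 ∧ IsGap (meetingTimes γ δ) a b ∧ P '' side m k = γ.toFun '' Ioo a b) ∨
    (ε = -1 ∧ IsGap (meetingTimes γ δ) b a ∧ P '' side m k = γ.toFun '' Ioo b a)

section Side

variable {γ δ α β : Curve S} {m : ℕ} {P : ℂ → S} {k : ℤ} {ε a b : ℝ}

theorem IsSideLift.add_mul (hm : m ≠ 0) (h : IsSideLift γ δ m P k ε a b) (q : ℤ) :
    IsSideLift γ δ m P (k + q * m) ε a b := by
  have e : vertex m (k + q * m + 1) = vertex m (k + 1) := by
    rw [add_right_comm, vertex_add_mul hm]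
  constructor
  · rw [vertex_add_mul hm]; exact h.map_left
  · rw [e]; exact h.map_right
  · rw [e, vertex_add_mul hm]; exact h.velocity_left
  · rw [e, vertex_add_mul hm]; exact h.velocity_right
  · rw [side_add_mul hm]; exact h.isGap

theorem exists_isSideLift [T2Space S] (hm : 3 ≤ m)
    (hP : ContMDiffOn 𝓘(ℝ, ℂ) (𝓡 2) 1 P (polygon m))
    (hreg : ∀ z ∈ polygon m, Function.Injective (tangentMap P (polygon m) z))
    (hv : ∀ k, P (vertex m k) ∈ γ.carrier ∩ δ.carrier) (hinj : InjOn P (side m k))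
    (hside : P '' side m k ⊆ γ.carrier \ δ.carrier) :
    ∃ ε a b, IsSideLift γ δ m P k ε a b := by
  set z := vertex m k with hz
  set w := vertex m (k + 1) with hw
  have hzK : z ∈ polygon m := vertex_mem_polygon k
  have hwK : w ∈ polygon m := vertex_mem_polygon (k + 1)
  have hzw : z ≠ w := vertex_ne_vertex_add_one hm k
  set ℓ : ℝ → ℂ := fun t => z + t • (w - z) with hℓ
  have hℓK : MapsTo ℓ (Icc 0 1) (polygon m) := fun t ht =>
    convex_polygon.add_smul_sub_mem hzK hwK ht
  have hℓside : ∀ t ∈ Ioo (0 : ℝ) 1, ℓ t ∈ side m k := fun t ht => by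
    rw [side_eq_image]
    exact mem_image_of_mem ℓ ht
  have hℓinj : Function.Injective ℓ := fun s t hst =>
    smul_left_injective ℝ (sub_ne_zero.2 hzw.symm) (add_left_cancel hst)
  have hℓ0 : ℓ 0 = z := by simp [hℓ]
  have hℓ1 : ℓ 1 = w := by simp [hℓ]
  have hℓc : Continuous ℓ := by fun_prop
  have hmid : ∀ t ∈ Ioo (0 : ℝ) 1, P (ℓ t) ∈ γ.carrier \ δ.carrier := fun t ht =>
    hside (mem_image_of_mem P (hℓside t ht))
  have himage : P '' side m k = (fun t => P (ℓ t)) '' Ioo 0 1 := by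
    rw [side_eq_image, image_image]
  have hmem : MapsTo (fun t => P (ℓ t)) (Icc 0 1) γ.carrier := by
    intro t ht
    rcases ht.1.eq_or_lt with rfl | h0
    · simpa [hℓ0] using (hv k).1
    rcases ht.2.eq_or_lt with rfl | h1
    · simpa [hℓ1] using (hv (k + 1)).1
    exact (hmid t ⟨h0, h1⟩).1
  obtain ⟨f, hf, hfl, hcases⟩ := γ.exists_lift_isGap δ (c := fun t => P (ℓ t))
    (hP.continuousOn.comp hℓc.continuousOn hℓK)
    (fun s hs t ht hst => hℓinj (hinj (hℓside s hs) (hℓside t ht) hst)) hmem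
    (fun t ht => (hmid t ht).2) (by simpa [hℓ0] using (hv k).2) (by simpa [hℓ1] using (hv (k + 1)).2)
  have key : ∀ ε : ℝ, ε * ε = 1 → (∀ t ∈ Ioo (0 : ℝ) 1, 0 < ε * (f t - f 0)) →
      (∀ t ∈ Ioo (0 : ℝ) 1, 0 < ε * (f 1 - f t)) →
      ((ε = 1 ∧ IsGap (meetingTimes γ δ) (f 0) (f 1) ∧ P '' side m k = γ.toFun '' Ioo (f 0) (f 1)) ∨
      (ε = -1 ∧ IsGap (meetingTimes γ δ) (f 1) (f 0) ∧
        P '' side m k = γ.toFun '' Ioo (f 1) (f 0))) →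
      IsSideLift γ δ m P k ε (f 0) (f 1) := by
    intro ε hε h0 h1 hg
    refine ⟨?_, ?_, ?_, ?_, hg⟩
    · simpa [hℓ0] using hfl 0 (by simp)
    · simpa [hℓ1] using hfl 1 (by simp)
    · exact γ.exists_pos_smul convex_polygon hP hzK hwK hzw (hreg z hzK) hf hfl hε h0
    -- The velocity at the far end comes from the side traversed backwards, whence `1 - t` and `-ε`.
    · obtain ⟨r, hr, he⟩ := γ.exists_pos_smul convex_polygon hP hwK hzK hzw.symm (hreg w hwK)
        (f := fun t => f (1 - t)) (by fun_prop)
        (fun t ht => by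
          rw [hfl (1 - t) ⟨by linarith [ht.2], by linarith [ht.1]⟩]
          congr 1
          simp only [hℓ, Complex.real_smul]
          push_cast
          ring)
        (ε := -ε) (by simpa using hε)
        (fun t ht => by
          have := h1 (1 - t) ⟨by linarith [ht.2], by linarith [ht.1]⟩
          simp only [sub_zero]
          linarith)
      refine ⟨r, hr, ?_⟩
      rw [← neg_sub, map_neg, he]
      simp
  rcases hcases with ⟨hg, hmon, him⟩ | ⟨hg, hmon, him⟩
  · exact ⟨1, f 0, f 1, key 1 (by norm_num) (fun t ht => by linarith [(hmon t ht).1])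
      (fun t ht => by linarith [(hmon t ht).2]) (Or.inl ⟨rfl, hg, himage.trans him⟩)⟩
  · exact ⟨-1, f 0, f 1, key (-1) (by norm_num) (fun t ht => by linarith [(hmon t ht).2])
      (fun t ht => by linarith [(hmon t ht).1]) (Or.inr ⟨rfl, hg, himage.trans him⟩)⟩

theorem IsSideLift.eq_one_or (h : IsSideLift γ δ m P k ε a b) : ε = 1 ∨ ε = -1 :=
  h.isGap.imp And.left And.left

/-- The relation between consecutive sides, from the orientation at their common vertex. -/
theorem IsSideLift.mul_det₂_pos (hm : 3 ≤ m) {s : ℝ}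
    (hs : ∀ z ∈ polygon m, 0 < s * det₂ (tangentMap P (polygon m) z 1)
      (tangentMap P (polygon m) z Complex.I))
    {γ' δ' : Curve S} {ε' a' b' : ℝ} (h : IsSideLift γ δ m P k ε a b)
    (h' : IsSideLift γ' δ' m P (k + 1) ε' a' b') :
    0 < s * (ε * ε') * det₂ (velocity γ.toFun b) (velocity γ'.toFun a') := by
  obtain ⟨r, hr, hu⟩ := h.velocity_right
  obtain ⟨r', hr', hw⟩ := h'.velocity_left
  have hdet := det₂_complex (tangentMap P (polygon m) (vertex m (k + 1)))
    (vertex m (k + 1) - vertex m k) (vertex m (k + 1 + 1) - vertex m (k + 1))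
  rw [hu, hw, det₂_smul_smul] at hdet
  have h1 := mul_pos (cross_sides_pos hm k) (hs _ (vertex_mem_polygon (k + 1)))
  have h2 : 0 < (r * r') * (s * (ε * ε') * det₂ (velocity γ.toFun b) (velocity γ'.toFun a')) := by
    calc _ < _ := h1
      _ = s * (ε * r * (ε' * r') * det₂ (velocity γ.toFun b) (velocity γ'.toFun a')) := by
        rw [hdet]; ring
      _ = _ := by ring
  exact (pos_iff_pos_of_mul_pos h2).1 (mul_pos hr hr')

/-- Two consecutive sides on the same curve would have parallel tangents at the image of their
common vertex, which the curve passes only once per period; the corner of the polygon is mapped to a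
nondegenerate one. -/
theorem IsSideLift.not_succ (hm : 3 ≤ m) {s : ℝ}
    (hs : ∀ z ∈ polygon m, 0 < s * det₂ (tangentMap P (polygon m) z 1)
      (tangentMap P (polygon m) z Complex.I))
    {ε' a' b' : ℝ} (h : IsSideLift γ δ m P k ε a b) :
    ¬ IsSideLift γ δ m P (k + 1) ε' a' b' := by
  intro h'
  have hpos := h.mul_det₂_pos hm hs h'
  obtain ⟨q, rfl⟩ := (γ.simple.2 b a').1 (h.map_right.trans h'.map_left.symm)
  rw [γ.velocity_add_int] at hpos
  have := det₂_smul_same 1 1 (velocity γ.toFun b)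
  simp only [one_smul] at this
  simp [this] at hpos

theorem IsSideLift.next (h : IsSideLift γ δ m P k 1 a b) :
    Next γ δ (P (vertex m k)) (P (vertex m (k + 1))) := by
  rcases h.isGap with ⟨-, hg, -⟩ | ⟨hε, -⟩
  · exact ⟨a, b, hg, h.map_left, h.map_right⟩
  · norm_num at hε

theorem IsSideLift.next_of_neg (h : IsSideLift γ δ m P k (-1) a b) :
    Next γ δ (P (vertex m (k + 1))) (P (vertex m k)) := by
  rcases h.isGap with ⟨hε, -⟩ | ⟨-, hg, -⟩
  · norm_num at hε
  · exact ⟨b, a, hg, h.map_right, h.map_left⟩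

/-- The end points of two sides that run on the same arc in opposite directions are glued. -/
theorem IsSideLift.vertex_eq {l : ℤ} {a' b' : ℝ} (h : IsSideLift γ δ m P k 1 a b)
    (h' : IsSideLift γ δ m P l (-1) a' b') (he : P '' side m k = P '' side m l) :
    P (vertex m k) = P (vertex m (l + 1)) ∧ P (vertex m (k + 1)) = P (vertex m l) := by
  rcases h.isGap with ⟨-, hg, hi⟩ | ⟨hε, -⟩
  · rcases h'.isGap with ⟨hε, -⟩ | ⟨-, hg', hi'⟩
    · norm_num at hε
    · rw [← h.map_left, ← h.map_right, ← h'.map_left, ← h'.map_right]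
      exact hg.eq_of_image_eq hg' (by rw [← hi, ← hi', he])
  · norm_num at hε

theorem IsSideLift.image_eq_of_next_self {l : ℤ} {a' b' : ℝ} {x : S} (hx : Next γ δ x x)
    (h : IsSideLift γ δ m P k 1 a b) (h' : IsSideLift γ δ m P l 1 a' b') :
    P '' side m k = P '' side m l := by
  rcases h.isGap with ⟨-, hg, hi⟩ | ⟨hε, -⟩
  · rcases h'.isGap with ⟨-, hg', hi'⟩ | ⟨hε, -⟩
    · rw [hi, hi', IsGap.image_eq_of_next_self hx hg hg']
    · norm_num at hε
  · norm_num at hε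

end Side

/-! ### The contradiction from opposite gluing -/

/-- If all crossings of `α` and `β` have the same sign, the `4n`-gon, `n` odd, has a side on `α`
that is not identified with the opposite side. -/
theorem exists_not_identified [T2Space S] [IsManifold (𝓡 2) ∞ S] (hor : IsOriented S)
    {α β : Curve S} (hfin : (α.carrier ∩ β.carrier).Finite) {C : ℝ}
    (hC : ∀ t u, α.toFun t = β.toFun u →
      0 < C * det₂ (velocity α.toFun t) (velocity β.toFun u))
    {n : ℕ} (hodd : Odd n) (hn : 3 ≤ n) {P : ℂ → S} (hP : IsCutPolygon α β (4 * n) P) :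
    ∃ k : ℤ, P '' side (4 * n) k ⊆ α.carrier ∧ ¬ Identified (4 * n) P k (k + 2 * n) := by
  by_contra! hopp
  simp only [Identified] at hopp
  have hm : 3 ≤ 4 * n := by omega
  have hreg : ∀ z ∈ polygon (4 * n), Function.Injective (tangentMap P (polygon (4 * n)) z) :=
    hP.regular
  obtain ⟨s, hs⟩ := exists_forall_mul_det₂_pos hor (uniqueDiffOn_polygon hm)
    convex_polygon.isPreconnected hP.contMDiffOn hreg
  have htype : ∀ k, (∃ ε a b, IsSideLift α β (4 * n) P k ε a b) ∨
      ∃ ε a b, IsSideLift β α (4 * n) P k ε a b := by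
    intro k
    rcases hP.image_side k with ⟨x, -, hx⟩ | ⟨x, -, hx⟩
    · exact Or.inl (exists_isSideLift hm hP.contMDiffOn hreg hP.map_vertex (hP.injOn_side k)
        (hx ▸ connectedComponentIn_subset _ _))
    · exact Or.inr (exists_isSideLift hm hP.contMDiffOn hreg
        (fun k => (hP.map_vertex k).symm) (hP.injOn_side k)
        (hx ▸ connectedComponentIn_subset _ _))
  have hαβ : ∀ {k ε a b}, IsSideLift α β (4 * n) P k ε a b →
      ∃ ε' a' b', IsSideLift β α (4 * n) P (k + 1) ε' a' b' ∧ 0 < s * C * (ε * ε') := by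
    intro k ε a b h
    rcases htype (k + 1) with ⟨ε', a', b', h'⟩ | ⟨ε', a', b', h'⟩
    · exact absurd h' (h.not_succ hm hs)
    · refine ⟨ε', a', b', h', ?_⟩
      have h1 := h.mul_det₂_pos hm hs h'
      have h2 := hC _ _ (h.map_right.trans h'.map_left.symm)
      -- The product of the two inequalities contains the determinant squared, which can be
      -- cancelled.
      nlinarith [mul_pos h1 h2, mul_self_nonneg
        (det₂ (velocity α.toFun b) (velocity β.toFun a'))]
  have hβα : ∀ {k ε a b}, IsSideLift β α (4 * n) P k ε a b →
      ∃ ε' a' b', IsSideLift α β (4 * n) P (k + 1) ε' a' b' ∧ s * C * (ε * ε') < 0 := by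
    intro k ε a b h
    rcases htype (k + 1) with ⟨ε', a', b', h'⟩ | ⟨ε', a', b', h'⟩
    · refine ⟨ε', a', b', h', ?_⟩
      have h1 := h.mul_det₂_pos hm hs h'
      have h2 := hC _ _ (h'.map_left.trans h.map_right.symm)
      rw [det₂_swap] at h1
      nlinarith [mul_pos h1 h2, mul_self_nonneg
        (det₂ (velocity α.toFun a') (velocity β.toFun b))]
    · exact absurd h' (h.not_succ hm hs)
  -- An α-β corner and a β-α corner carry opposite signs, so the direction flips from one α-side to
  -- the next.
  have hαα : ∀ {k ε a b}, IsSideLift α β (4 * n) P k ε a b →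
      ∃ a' b', IsSideLift α β (4 * n) P (k + 2) (-ε) a' b' := by
    intro k ε a b h
    obtain ⟨ε', a', b', h', hpos⟩ := hαβ h
    obtain ⟨ε'', a'', b'', h'', hneg⟩ := hβα h'
    have : ε'' = -ε := by
      rcases h.eq_one_or with rfl | rfl <;> rcases h''.eq_one_or with rfl | rfl <;>
        first | (norm_num; done) | (exfalso; linarith)
    subst this
    exact ⟨a'', b'', by rwa [add_assoc] at h''⟩
  -- The bound 3 keeps `k₀ + 8` below 12 ≤ 4n, as the final count of sides needs.
  obtain ⟨k₀, hk₀, hk₀', a₀, b₀, hl₀⟩ : ∃ k₀ : ℤ, 0 ≤ k₀ ∧ k₀ ≤ 3 ∧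
      ∃ a b, IsSideLift α β (4 * n) P k₀ 1 a b := by
    obtain ⟨k, hk, hk', ε, a, b, h⟩ : ∃ k : ℤ, 0 ≤ k ∧ k ≤ 1 ∧
        ∃ ε a b, IsSideLift α β (4 * n) P k ε a b := by
      rcases htype 0 with h | ⟨ε, a, b, h⟩
      · exact ⟨0, by norm_num, by norm_num, h⟩
      · obtain ⟨ε', a', b', h', -⟩ := hβα h
        exact ⟨1, by norm_num, by norm_num, ε', a', b', h'⟩
    rcases h.eq_one_or with rfl | rfl
    · exact ⟨k, hk, by omega, a, b, h⟩
    · obtain ⟨a', b', h'⟩ := hαα h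
      exact ⟨k + 2, by omega, by omega, a', b', by simpa using h'⟩
  have hfour : ∀ i : ℕ, ∃ a b, IsSideLift α β (4 * n) P (k₀ + 4 * i) 1 a b := by
    intro i
    induction i with
    | zero => exact ⟨a₀, b₀, by simpa using hl₀⟩
    | succ i ih =>
      obtain ⟨a, b, h⟩ := ih
      obtain ⟨a', b', h'⟩ := hαα h
      obtain ⟨a'', b'', h''⟩ := hαα h'
      refine ⟨a'', b'', ?_⟩
      convert h'' using 1
      · push_cast; ring
      · norm_num
  have hα₀ : ∀ i : ℤ, ∃ a b, IsSideLift α β (4 * n) P (k₀ + 4 * i) 1 a b := by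
    intro i
    obtain ⟨a, b, h⟩ := hfour (i + n * i.natAbs).toNat
    refine ⟨a, b, ?_⟩
    have hnn : 0 ≤ i + n * i.natAbs := by
      have h1 : (1 : ℤ) * i.natAbs ≤ n * i.natAbs :=
        mul_le_mul_of_nonneg_right (by omega) (by positivity)
      omega
    convert h.add_mul (by omega) (-(i.natAbs : ℤ)) using 1
    rw [Int.toNat_of_nonneg hnn]
    push_cast
    ring
  have hα₂ : ∀ i : ℤ, ∃ a b, IsSideLift α β (4 * n) P (k₀ + 4 * i + 2) (-1) a b := fun i => by
    obtain ⟨a, b, h⟩ := hα₀ i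
    exact hαα h
  obtain ⟨σ, hσ, hσC⟩ : ∃ σ : ℝ, (σ = 1 ∨ σ = -1) ∧ 0 < s * C * σ := by
    obtain ⟨σ, a, b, h, hpos⟩ := hαβ hl₀
    exact ⟨σ, h.eq_one_or, by simpa using hpos⟩
  have hβ₁ : ∀ i : ℤ, ∃ a b, IsSideLift β α (4 * n) P (k₀ + 4 * i + 1) σ a b := by
    intro i
    obtain ⟨a, b, h⟩ := hα₀ i
    obtain ⟨ε, a', b', h', hpos⟩ := hαβ h
    have : ε = σ := by
      rcases hσ with rfl | rfl <;> rcases h'.eq_one_or with rfl | rfl <;>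
        first | rfl | (exfalso; linarith)
    exact ⟨a', b', this ▸ h'⟩
  have hβ₃ : ∀ i : ℤ, ∃ a b, IsSideLift β α (4 * n) P (k₀ + 4 * i + 3) (-σ) a b := by
    intro i
    obtain ⟨a, b, h⟩ := hα₂ i
    obtain ⟨ε, a', b', h', hpos⟩ := hαβ h
    have : ε = -σ := by
      rcases hσ with rfl | rfl <;> rcases h'.eq_one_or with rfl | rfl <;>
        first | (norm_num; done) | (exfalso; linarith)
    exact ⟨a', b', by rw [← this]; convert h' using 1; ring⟩
  have hglue : ∀ i : ℤ, P (vertex (4 * n) (k₀ + 4 * i)) = P (vertex (4 * n) (k₀ + 4 * i + 2 * n + 1)) ∧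
      P (vertex (4 * n) (k₀ + 4 * i + 1)) = P (vertex (4 * n) (k₀ + 4 * i + 2 * n)) := by
    intro i
    obtain ⟨a, b, h⟩ := hα₀ i
    obtain ⟨j, hj⟩ := hodd
    obtain ⟨a', b', h'⟩ := hα₂ (i + j)
    -- Oddness enters here: with n = 2j + 1 the opposite side has offset 4j + 2, so it runs
    -- backwards.
    have e : k₀ + 4 * (i + j) + 2 = k₀ + 4 * i + 2 * n := by rw [hj]; push_cast; ring
    rw [e] at h'
    refine h.vertex_eq h' (hopp _ ?_)
    rcases h.isGap with ⟨-, -, hi⟩ | ⟨hε, -⟩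
    · rw [hi]
      exact image_subset_range _ _
    · norm_num at hε
  set v : ℤ → S := fun i => P (vertex (4 * n) (k₀ + i)) with hv
  have hve : ∀ {i j}, k₀ + i = j → P (vertex (4 * n) j) = v i := by
    rintro i _ rfl
    rfl
  have hvmem : ∀ i, v i ∈ β.carrier ∩ α.carrier := fun i => (hP.map_vertex _).symm
  have hfin' : (β.carrier ∩ α.carrier).Finite := by rwa [inter_comm]
  -- `B` is the successor along β or its inverse, according to the direction `σ` of the β-sides
  -- following forward α-sides.
  obtain ⟨B, hBfun, hB₁, hB₃, hirr⟩ : ∃ B : S → S → Prop, (∀ x y z, B x y → B x z → y = z) ∧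
      (∀ i, B (v (4 * i + 1)) (v (4 * i + 2))) ∧ (∀ i, B (v (4 * i + 4)) (v (4 * i + 3))) ∧
      (∀ Y : Set S, v 0 ∈ Y → (∀ x ∈ Y, ∀ y, B x y → y ∈ Y) → v 1 ∈ Y) := by
    rcases hσ with rfl | rfl
    · refine ⟨Next β α, fun x y z h h' => h.right_unique h', fun i => ?_, fun i => ?_,
        Next.mem_of_mem hfin' (hvmem 0) (hvmem 1)⟩
      · obtain ⟨a, b, h⟩ := hβ₁ i
        rw [← hve (add_assoc k₀ (4 * i) 1).symm, ← hve (j := k₀ + 4 * i + 1 + 1) (by ring)]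
        exact h.next
      · obtain ⟨a, b, h⟩ := hβ₃ i
        rw [← hve (add_assoc k₀ (4 * i) 3).symm, ← hve (j := k₀ + 4 * i + 3 + 1) (by ring)]
        exact h.next_of_neg
    · refine ⟨fun x y => Next β α y x, fun x y z h h' => h.left_unique h', fun i => ?_, fun i => ?_,
        Next.mem_of_mem_flip hfin' (hvmem 0) (hvmem 1)⟩
      · obtain ⟨a, b, h⟩ := hβ₁ i
        rw [← hve (add_assoc k₀ (4 * i) 1).symm, ← hve (j := k₀ + 4 * i + 1 + 1) (by ring)]
        exact h.next_of_neg
      · obtain ⟨a, b, h⟩ := hβ₃ i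
        rw [neg_neg] at h
        rw [← hve (add_assoc k₀ (4 * i) 3).symm, ← hve (j := k₀ + 4 * i + 3 + 1) (by ring)]
        exact h.next
  obtain ⟨x, hx⟩ := exists_rel_self v n (by exact_mod_cast hodd) (by omega)
    (fun k => by
      simp only [hv]
      rw [← vertex_add_mul (m := 4 * n) (by omega) (k₀ + k) 1]
      congr 2
      push_cast
      ring)
    (Next α β) B hBfun
    (fun i => by
      obtain ⟨a, b, h⟩ := hα₀ i
      rw [← hve (j := k₀ + 4 * i) rfl, ← hve (j := k₀ + 4 * i + 1) (by ring)]
      exact h.next)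
    hB₁ hB₃
    (fun i => by
      rw [← hve (j := k₀ + 4 * i) rfl, ← hve (j := k₀ + 4 * i + 2 * n + 1) (by ring)]
      exact (hglue i).1.symm)
    (fun i => by
      rw [← hve (add_assoc k₀ (4 * i) 1).symm, ← hve (add_assoc k₀ (4 * i) (2 * n)).symm]
      exact (hglue i).2.symm)
    hirr
  have hsame : ∀ i : ℤ, P '' side (4 * n) (k₀ + 4 * i) = P '' side (4 * n) k₀ := by
    intro i
    obtain ⟨a, b, h⟩ := hα₀ i
    exact h.image_eq_of_next_self hx hl₀
  -- The sides `k₀`, `k₀ + 4`, `k₀ + 8` would be three copies of one arc.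
  obtain ⟨p, q, -, hpq⟩ := ncard_eq_two.1 (hP.two_copies _ (hP.image_side k₀))
  have hmem : ∀ i : ℤ, 0 ≤ i → i ≤ 2 → k₀ + 4 * i = p ∨ k₀ + 4 * i = q := by
    intro i hi hi'
    have : k₀ + 4 * i ∈ ({p, q} : Set ℤ) := by
      rw [← hpq]
      exact ⟨by omega, by push_cast; omega, hsame i⟩
    simpa using this
  have h0 := hmem 0 (by norm_num) (by norm_num)
  have h1 := hmem 1 (by norm_num) (by norm_num)
  have h2 := hmem 2 (by norm_num) (by norm_num)
  omega

theorem IsCutPolygon.symm {α β : Curve S} {m : ℕ} {P : ℂ → S} (h : IsCutPolygon α β m P) :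
    IsCutPolygon β α m P where
  contMDiffOn := h.contMDiffOn
  regular := h.regular
  bijOn_interior := by rw [union_comm]; exact h.bijOn_interior
  map_vertex k := (h.map_vertex k).symm
  injOn_side := h.injOn_side
  image_side k := (h.image_side k).symm
  two_copies e he := h.two_copies e he.symm

/-! ### Coherence and the signs of crossings -/

/-- All crossings of coherently intersecting curves in minimal position have the same sign. -/
theorem IntersectCoherently.exists_sign {α β : Curve S} (hcoh : IntersectCoherently α β)
    (hpos : InMinimalPosition α β) :
    (α.carrier ∩ β.carrier).Finite ∧ ∃ C : ℝ, ∀ t u, α.toFun t = β.toFun u →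
      0 < C * det₂ (velocity α.toFun t) (velocity β.toFun u) := by
  have hcard : (α.carrier ∩ β.carrier).encard = ((algebraicIntersection α β).natAbs : ℕ∞) :=
    hpos.2.trans hcoh.symm
  have hfin : (α.carrier ∩ β.carrier).Finite := finite_of_encard_eq_coe hcard
  refine ⟨hfin, ?_⟩
  have hIco : ∀ {γ : Curve S} {s t : ℝ}, s ∈ Ico (0 : ℝ) 1 → t ∈ Ico (0 : ℝ) 1 →
      γ.toFun s = γ.toFun t → s = t := by
    intro γ s t hs ht h
    obtain ⟨k, rfl⟩ := (γ.simple.2 _ _).1 h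
    have h1 : (-1 : ℝ) < k := by linarith [hs.2, ht.1]
    have h2 : (k : ℝ) < 1 := by linarith [hs.1, ht.2]
    have h3 : -1 < k := by exact_mod_cast h1
    have h4 : k < 1 := by exact_mod_cast h2
    have : k = 0 := by omega
    simp [this]
  have hinj : InjOn (fun p : ℝ × ℝ => α.toFun p.1) (crossings α β) := by
    rintro ⟨a, b⟩ ⟨ha, hb, hab⟩ ⟨a', b'⟩ ⟨ha', hb', hab'⟩ (h : α.toFun a = α.toFun a')
    exact Prod.ext (hIco ha ha' h) (hIco hb hb' (hab.symm.trans (h.trans hab')))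
  have hmaps : MapsTo (fun p : ℝ × ℝ => α.toFun p.1) (crossings α β) (α.carrier ∩ β.carrier) := by
    rintro ⟨a, b⟩ ⟨-, -, hab⟩
    exact ⟨⟨a, rfl⟩, ⟨b, hab.symm⟩⟩
  have hX : (crossings α β).Finite := hfin.of_injOn hmaps hinj
  have hle : hX.toFinset.card ≤ (algebraicIntersection α β).natAbs := by
    have h1 : (crossings α β).encard ≤ (α.carrier ∩ β.carrier).encard :=
      encard_le_encard_of_injOn hmaps hinj
    rw [hcard, hX.encard_eq_coe_toFinset_card] at h1
    exact_mod_cast h1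
  set σ : ℝ × ℝ → ℤ := fun p =>
    ((SignType.sign (det₂ (velocity α.toFun p.1) (velocity β.toFun p.2)) : SignType) : ℤ) with hσ
  have hsum : algebraicIntersection α β = ∑ p ∈ hX.toFinset, σ p :=
    finsum_mem_eq_finite_toFinset_sum _ hX
  have hσ1 : ∀ p, σ p ≤ 1 ∧ -1 ≤ σ p := by
    intro p
    simp only [hσ]
    generalize SignType.sign (det₂ (velocity α.toFun p.1) (velocity β.toFun p.2)) = x
    cases x <;> simp
  -- A sum of signs whose absolute value is at least the number of terms has all terms equal to 1 or
  -- all equal to −1.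
  have hall : (∀ p ∈ crossings α β, σ p = 1) ∨ ∀ p ∈ crossings α β, σ p = -1 := by
    rcases le_total 0 (algebraicIntersection α β) with h0 | h0
    · left
      have h1 : ∑ p ∈ hX.toFinset, (1 - σ p) ≤ 0 := by
        rw [Finset.sum_sub_distrib, ← hsum]
        simp only [Finset.sum_const, nsmul_eq_mul, mul_one]
        omega
      have h2 := (Finset.sum_eq_zero_iff_of_nonneg
        (fun p _ => by linarith [(hσ1 p).1])).1 (le_antisymm h1
          (Finset.sum_nonneg fun p _ => by linarith [(hσ1 p).1]))
      intro p hp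
      linarith [h2 p (hX.mem_toFinset.2 hp)]
    · right
      have h1 : ∑ p ∈ hX.toFinset, (1 + σ p) ≤ 0 := by
        rw [Finset.sum_add_distrib, ← hsum]
        simp only [Finset.sum_const, nsmul_eq_mul, mul_one]
        omega
      have h2 := (Finset.sum_eq_zero_iff_of_nonneg
        (fun p _ => by linarith [(hσ1 p).2])).1 (le_antisymm h1
          (Finset.sum_nonneg fun p _ => by linarith [(hσ1 p).2]))
      intro p hp
      linarith [h2 p (hX.mem_toFinset.2 hp)]
  have hreduce : ∀ t u, α.toFun t = β.toFun u → ∃ p ∈ crossings α β,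
      velocity α.toFun t = velocity α.toFun p.1 ∧ velocity β.toFun u = velocity β.toFun p.2 := by
    intro t u h
    have ht : Int.fract t + (⌊t⌋ : ℤ) = t := Int.fract_add_floor t
    have hu : Int.fract u + (⌊u⌋ : ℤ) = u := Int.fract_add_floor u
    refine ⟨(Int.fract t, Int.fract u), ⟨⟨Int.fract_nonneg t, Int.fract_lt_one t⟩,
      ⟨Int.fract_nonneg u, Int.fract_lt_one u⟩, ?_⟩, ?_, ?_⟩
    · rw [← α.add_int _ ⌊t⌋, ← β.add_int _ ⌊u⌋, ht, hu, h]
    · rw [← α.velocity_add_int (Int.fract t) ⌊t⌋, ht]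
    · rw [← β.velocity_add_int (Int.fract u) ⌊u⌋, hu]
  rcases hall with h1 | h1
  · refine ⟨1, fun t u h => ?_⟩
    obtain ⟨p, hp, h2, h3⟩ := hreduce t u h
    rw [h2, h3, one_mul, ← sign_eq_one_iff]
    have := h1 p hp
    simp only [hσ] at this
    revert this
    generalize SignType.sign (det₂ (velocity α.toFun p.1) (velocity β.toFun p.2)) = x
    cases x <;> simp
  · refine ⟨-1, fun t u h => ?_⟩
    obtain ⟨p, hp, h2, h3⟩ := hreduce t u h
    rw [h2, h3, neg_one_mul, neg_pos, ← sign_eq_neg_one_iff]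
    have := h1 p hp
    simp only [hσ] at this
    revert this
    generalize SignType.sign (det₂ (velocity α.toFun p.1) (velocity β.toFun p.2)) = x
    cases x <;> simp

end

end FillingPairs

theorem proposition4 {S : Type u} [TopologicalSpace S]
    [ChartedSpace (EuclideanSpace ℝ (Fin 2)) S] (g : ℕ) (hg : 3 ≤ g)
    (hS : FillingPairs.IsClosedSurface g S) (α β : FillingPairs.Curve S)
    (hmin : FillingPairs.IsMinimallyIntersecting α β)
    (hcoh : FillingPairs.IntersectCoherently α β)
    (P : ℂ → S) (hP : FillingPairs.IsCutPolygon α β (4 * (2 * g - 1)) P) :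
    (∃ k : ℤ, P '' FillingPairs.side (4 * (2 * g - 1)) k ⊆ α.carrier ∧
      ¬ FillingPairs.Identified (4 * (2 * g - 1)) P k (k + 2 * (2 * g - 1))) ∧
    (∃ k : ℤ, P '' FillingPairs.side (4 * (2 * g - 1)) k ⊆ β.carrier ∧
      ¬ FillingPairs.Identified (4 * (2 * g - 1)) P k (k + 2 * (2 * g - 1))) := by
  have := hS.t2
  have := hS.smooth
  obtain ⟨hfin, C, hC⟩ := hcoh.exists_sign hmin.1.1
  have hodd : Odd (2 * g - 1) := ⟨g - 1, by omega⟩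
  have hcast : (((2 * g - 1 : ℕ) : ℤ)) = 2 * g - 1 := by omega
  rw [← hcast]
  refine ⟨FillingPairs.exists_not_identified hS.oriented hfin hC hodd (by omega) hP,
    -- Exchanging the curves changes the sign of every crossing, hence `-C`.
    FillingPairs.exists_not_identified hS.oriented (C := -C) (by rwa [inter_comm])
      (fun t u h => ?_) hodd (by omega) hP.symm⟩
  rw [FillingPairs.det₂_swap]
  have := hC u t h.symm
  linarith
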